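/- For a matrix $A$ let $\mathrm{vec}(A)$ be the vector obtained by stacking the columns of $A$, let $\otimes$ be the Kronecker product, and let $K_{ab}$ be the permutation matrix with $\mathrm{vec}(A^\top)=K_{ab}\,\mathrm{vec}(A)$ for every $A\in\mathbb{R}^{a\times b}$. Let $\bar Y\in\mathbb{R}^{n\times m}$, and for $P\in\mathbb{R}^{n\times k}$, $Q\in\mathbb{R}^{m\times k}$ and $z=[\mathrm{vec}(P);\mathrm{vec}(Q)]$ let $$f_z(z)=\begin{bmatrix}\mathrm{vec}\big((\bar Y-PQ^\top)Q\big)\\ \mathrm{vec}\big((\bar Y-PQ^\top)^\top P\big)\end{bmatrix}$$ be the vectorized gradient flow of $\tfrac12\|\bar Y-PQ^\top\|_F^2$. Suppose that $PQ^\top=\bar Y$. (1) $f_z$ is differentiable at $z$, and its Jacobian there is $$J=-\begin{bmatrix} Q^\top Q\otimes I_n & (Q^\top\otimes P)K_{mk}\\ (P^\top\otimes Q)K_{nk} & P^\top P\otimes I_m\end{bmatrix}.$$ (2) Suppose moreover that $\operatorname{rank}\bar Y=m$, and let $\bar p=\operatorname{rank}P$. Then $P$ and $Q$ have full singular value decompositions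 of the form $$P=\begin{bmatrix}\Psi_2&\Psi_3\end{bmatrix}\begin{bmatrix}\bar\Sigma_P&0\\0&0\end{bmatrix}\begin{bmatrix}\Gamma_{2,P}&\Gamma_{3,P}\end{bmatrix}^\top,\qquad Q=\Phi\begin{bmatrix}\bar\Sigma_Q&0\end{bmatrix}\begin{bmatrix}\Gamma_{2,Q}&\Gamma_{3,Q}\end{bmatrix}^\top,$$ where $\Psi=[\Psi_2\ \Psi_3]$, $[\Gamma_{2,P}\ \Gamma_{3,P}]$, $\Phi$ and $[\Gamma_{2,Q}\ \Gamma_{3,Q}]$ are orthogonal matrices, $\bar\Sigma_P\in\mathbb{R}^{\bar p\times\bar p}$ and $\bar\Sigma_Q\in\mathbb{R}^{m\times m}$ are diagonal with positive diagonal entries, $\Psi_2$ and $\Gamma_{2,P}$ have $\bar p$ columns, and $\Gamma_{2,Q}$ has $m$ columns. For all such decompositions, put $$V_1=\begin{bmatrix}(\Gamma_{2,Q}\bar\Sigma_Q)\otimes\Psi_2\\ K_{mk}^\top\big(\Phi\otimes(\Gamma_{2,P}\bar\Sigma_P)\big)\end{bmatrix},\quad V_2=\begin{bmatrix}\Gamma_{2,Q}\otimes\Psi_3\\0\end{bmatrix},\quad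 V_3=\begin{bmatrix}-\Gamma_{2,Q}\otimes(\Psi_2\bar\Sigma_P)\\ K_{mk}^\top\big((\Phi\bar\Sigma_Q)\otimes\Gamma_{2,P}\big)\end{bmatrix},$$ $$V_4=\begin{bmatrix}\Gamma_{3,Q}\otimes\Psi\\0\end{bmatrix},\quad V_5=\begin{bmatrix}0\\ K_{mk}^\top(\Phi\otimes\Gamma_{3,P})\end{bmatrix}.$$ Then the columns of $V=[V_1\ V_2\ V_3\ V_4\ V_5]$ are pairwise orthogonal and form a basis of $\mathbb{R}^{(n+m)k}$ consisting of eigenvectors of $J$. The corresponding eigenvalues are the diagonal entries of the diagonal matrix $$\Lambda=-\operatorname{diag}\big(\bar\Sigma_Q^2\otimes I+I\otimes\bar\Sigma_P^2,\ \bar\Sigma_Q^2\otimes I,\ 0,\ 0,\ 0\big)$$ (block diagonal, with blocks matching $V_1,\dots,V_5$). These entries are the eigenvalues of $J$ counted with multiplicity; those in the first two blocks are negative and all others are zero. -/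

import Mathlib

open Matrix
open scoped Kronecker

namespace GradFlow

/-! Vectorization is `Matrix.vec` (stacking of columns); for `A : Matrix (Fin a) (Fin b) ℝ` the vector
`vec A` is indexed by `Fin b × Fin a`, in the order that matches the Kronecker product `⊗ₖ`. -/

/-- Index type of the stacked vector `z = [vec P; vec Q]`, with `P` of size `n × k` and `Q` of size
`m × k`. -/
abbrev StateIdx (n m k : ℕ) : Type := (Fin k × Fin n) ⊕ (Fin k × Fin m)

/-- The inverse of `vec`. -/
def unvec {a b : ℕ} (v : Fin b × Fin a → ℝ) : Matrix (Fin a) (Fin b) ℝ :=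
  Matrix.of fun i j => v (j, i)

theorem unvec_vec {a b : ℕ} (A : Matrix (Fin a) (Fin b) ℝ) : unvec (vec A) = A := rfl

theorem vec_unvec {a b : ℕ} (v : Fin b × Fin a → ℝ) : vec (unvec v) = v := rfl

/-- The stacked vector `z = [vec P; vec Q]`. -/
def stack {n m k : ℕ} (P : Matrix (Fin n) (Fin k) ℝ) (Q : Matrix (Fin m) (Fin k) ℝ) :
    StateIdx n m k → ℝ :=
  Sum.elim (vec P) (vec Q)

/-- The vectorized gradient flow `f_z(z) = [vec ((Y - P Qᵀ) Q); vec ((Y - P Qᵀ)ᵀ P)]`,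
where `z = [vec P; vec Q]`. -/
def vecFlow {n m k : ℕ} (Y : Matrix (Fin n) (Fin m) ℝ) (z : StateIdx n m k → ℝ) :
    StateIdx n m k → ℝ :=
  let P : Matrix (Fin n) (Fin k) ℝ := unvec fun x => z (Sum.inl x)
  let Q : Matrix (Fin m) (Fin k) ℝ := unvec fun x => z (Sum.inr x)
  stack ((Y - P * Qᵀ) * Q) ((Y - P * Qᵀ)ᵀ * P)

/-- The commutation matrix `K_{ab}`: the permutation matrix with `vec Aᵀ = K_{ab} vec A` for every
`a × b` matrix `A`. -/
def commMatrix (a b : ℕ) : Matrix (Fin a × Fin b) (Fin b × Fin a) ℝ :=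
  (1 : Matrix (Fin b × Fin a) (Fin b × Fin a) ℝ).submatrix Prod.swap id

theorem commMatrix_mulVec_vec {a b : ℕ} (A : Matrix (Fin a) (Fin b) ℝ) :
    commMatrix a b *ᵥ vec A = vec Aᵀ := by
  ext x
  simp [commMatrix, mulVec, dotProduct, one_apply]

/-- The equation `vec Aᵀ = K vec A` for all `A` determines `K`. -/
theorem eq_commMatrix {a b : ℕ} (K : Matrix (Fin a × Fin b) (Fin b × Fin a) ℝ)
    (h : ∀ A : Matrix (Fin a) (Fin b) ℝ, K *ᵥ vec A = vec Aᵀ) : K = commMatrix a b := by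
  apply Matrix.ext_of_mulVec_single
  intro x
  have h1 := h (unvec (Pi.single x 1))
  have h2 := commMatrix_mulVec_vec (unvec (Pi.single x 1))
  rw [vec_unvec] at h1 h2
  rw [h1, h2]

/-- The matrix `-[[QᵀQ ⊗ I, (Qᵀ ⊗ P) K_{mk}], [(Pᵀ ⊗ Q) K_{nk}, PᵀP ⊗ I]]`. -/
def targetJacobian {n m k : ℕ} (P : Matrix (Fin n) (Fin k) ℝ) (Q : Matrix (Fin m) (Fin k) ℝ) :
    Matrix (StateIdx n m k) (StateIdx n m k) ℝ :=
  -fromBlocks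
    ((Qᵀ * Q) ⊗ₖ (1 : Matrix (Fin n) (Fin n) ℝ)) ((Qᵀ ⊗ₖ P) * commMatrix m k)
    ((Pᵀ ⊗ₖ Q) * commMatrix n k) ((Pᵀ * P) ⊗ₖ (1 : Matrix (Fin m) (Fin m) ℝ))

/-- Real orthogonal matrix; rows and columns may be indexed by different types, so that the columns
can be split into blocks. -/
def IsOrthogonal {ι κ : Type} [Fintype ι] [Fintype κ] [DecidableEq ι] [DecidableEq κ]
    (U : Matrix ι κ ℝ) : Prop :=
  Uᵀ * U = 1 ∧ U * Uᵀ = 1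

/-- `P = [Ψ₂ Ψ₃] [[Σ, 0], [0, 0]] [Γ₂ Γ₃]ᵀ` is a full singular value decomposition of `P`, where
`Σ = diag σ` carries the nonzero singular values (of which there are `rank P`). -/
structure IsPartitionedSVD {n k : ℕ} (P : Matrix (Fin n) (Fin k) ℝ)
    (Ψ₂ : Matrix (Fin n) (Fin P.rank) ℝ) (Ψ₃ : Matrix (Fin n) (Fin (n - P.rank)) ℝ)
    (σ : Fin P.rank → ℝ)
    (Γ₂ : Matrix (Fin k) (Fin P.rank) ℝ) (Γ₃ : Matrix (Fin k) (Fin (k - P.rank)) ℝ) : Prop where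
  left_orthogonal : IsOrthogonal (fromCols Ψ₂ Ψ₃)
  right_orthogonal : IsOrthogonal (fromCols Γ₂ Γ₃)
  pos : ∀ i, 0 < σ i
  eq : P = fromCols Ψ₂ Ψ₃ *
    (fromBlocks (diagonal σ) 0 0 0 :
      Matrix (Fin P.rank ⊕ Fin (n - P.rank)) (Fin P.rank ⊕ Fin (k - P.rank)) ℝ) *
    (fromCols Γ₂ Γ₃)ᵀ

/-- `Q = Φ [Σ 0] [Γ₂ Γ₃]ᵀ` is a full singular value decomposition of an `m × k` matrix `Q` of
rank `m`, where `Σ = diag σ` carries the `m` (nonzero) singular values. -/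
structure IsFullRowRankSVD {m k : ℕ} (Q : Matrix (Fin m) (Fin k) ℝ)
    (Φ : Matrix (Fin m) (Fin m) ℝ) (σ : Fin m → ℝ)
    (Γ₂ : Matrix (Fin k) (Fin m) ℝ) (Γ₃ : Matrix (Fin k) (Fin (k - m)) ℝ) : Prop where
  left_orthogonal : IsOrthogonal Φ
  right_orthogonal : IsOrthogonal (fromCols Γ₂ Γ₃)
  pos : ∀ i, 0 < σ i
  eq : Q = Φ * (fromCols (diagonal σ) 0 : Matrix (Fin m) (Fin m ⊕ Fin (k - m)) ℝ) * (fromCols Γ₂ Γ₃)ᵀ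

/-- Column index of `V₁, …, V₅`, where `p` stands for the rank of `P`. -/
abbrev EigIdx (n m k p : ℕ) : Type :=
  (Fin m × Fin p) ⊕ (Fin m × Fin (n - p)) ⊕ (Fin m × Fin p) ⊕
    (Fin (k - m) × (Fin p ⊕ Fin (n - p))) ⊕ (Fin m × Fin (k - p))

section Eigenbasis

variable {n m k p : ℕ}

/-- `V₁ = [(Γ_{2,Q} Σ_Q) ⊗ Ψ₂; K_{mk}ᵀ (Φ ⊗ (Γ_{2,P} Σ_P))]`. -/
def V₁ (Ψ₂ : Matrix (Fin n) (Fin p) ℝ) (σP : Fin p → ℝ) (ΓP₂ : Matrix (Fin k) (Fin p) ℝ)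
    (Φ : Matrix (Fin m) (Fin m) ℝ) (σQ : Fin m → ℝ) (ΓQ₂ : Matrix (Fin k) (Fin m) ℝ) :
    Matrix (StateIdx n m k) (Fin m × Fin p) ℝ :=
  fromRows ((ΓQ₂ * diagonal σQ) ⊗ₖ Ψ₂)
    ((commMatrix m k)ᵀ * (Φ ⊗ₖ (ΓP₂ * diagonal σP)))

/-- `V₂ = [Γ_{2,Q} ⊗ Ψ₃; 0]`. -/
def V₂ (Ψ₃ : Matrix (Fin n) (Fin (n - p)) ℝ) (ΓQ₂ : Matrix (Fin k) (Fin m) ℝ) :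
    Matrix (StateIdx n m k) (Fin m × Fin (n - p)) ℝ :=
  fromRows (ΓQ₂ ⊗ₖ Ψ₃) 0

/-- `V₃ = [-Γ_{2,Q} ⊗ (Ψ₂ Σ_P); K_{mk}ᵀ ((Φ Σ_Q) ⊗ Γ_{2,P})]`. -/
def V₃ (Ψ₂ : Matrix (Fin n) (Fin p) ℝ) (σP : Fin p → ℝ) (ΓP₂ : Matrix (Fin k) (Fin p) ℝ)
    (Φ : Matrix (Fin m) (Fin m) ℝ) (σQ : Fin m → ℝ) (ΓQ₂ : Matrix (Fin k) (Fin m) ℝ) :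
    Matrix (StateIdx n m k) (Fin m × Fin p) ℝ :=
  fromRows ((-ΓQ₂) ⊗ₖ (Ψ₂ * diagonal σP))
    ((commMatrix m k)ᵀ * ((Φ * diagonal σQ) ⊗ₖ ΓP₂))

/-- `V₄ = [Γ_{3,Q} ⊗ Ψ; 0]` with `Ψ = [Ψ₂ Ψ₃]`. -/
def V₄ (Ψ₂ : Matrix (Fin n) (Fin p) ℝ) (Ψ₃ : Matrix (Fin n) (Fin (n - p)) ℝ)
    (ΓQ₃ : Matrix (Fin k) (Fin (k - m)) ℝ) :
    Matrix (StateIdx n m k) (Fin (k - m) × (Fin p ⊕ Fin (n - p))) ℝ :=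
  fromRows (ΓQ₃ ⊗ₖ fromCols Ψ₂ Ψ₃) 0

/-- `V₅ = [0; K_{mk}ᵀ (Φ ⊗ Γ_{3,P})]`. -/
def V₅ (ΓP₃ : Matrix (Fin k) (Fin (k - p)) ℝ) (Φ : Matrix (Fin m) (Fin m) ℝ) :
    Matrix (StateIdx n m k) (Fin m × Fin (k - p)) ℝ :=
  fromRows 0 ((commMatrix m k)ᵀ * (Φ ⊗ₖ ΓP₃))

/-- `V = [V₁ V₂ V₃ V₄ V₅]`. -/
def eigenMatrix
    (Ψ₂ : Matrix (Fin n) (Fin p) ℝ) (Ψ₃ : Matrix (Fin n) (Fin (n - p)) ℝ) (σP : Fin p → ℝ)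
    (ΓP₂ : Matrix (Fin k) (Fin p) ℝ) (ΓP₃ : Matrix (Fin k) (Fin (k - p)) ℝ)
    (Φ : Matrix (Fin m) (Fin m) ℝ) (σQ : Fin m → ℝ)
    (ΓQ₂ : Matrix (Fin k) (Fin m) ℝ) (ΓQ₃ : Matrix (Fin k) (Fin (k - m)) ℝ) :
    Matrix (StateIdx n m k) (EigIdx n m k p) ℝ :=
  fromCols (V₁ Ψ₂ σP ΓP₂ Φ σQ ΓQ₂) <| fromCols (V₂ Ψ₃ ΓQ₂) <|
    fromCols (V₃ Ψ₂ σP ΓP₂ Φ σQ ΓQ₂) <| fromCols (V₄ Ψ₂ Ψ₃ ΓQ₃) (V₅ ΓP₃ Φ)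

/-- `Λ = -diag(Σ_Q² ⊗ I + I ⊗ Σ_P², Σ_Q² ⊗ I, 0, 0, 0)` (block diagonal). -/
def eigenvalueMatrix (n k : ℕ) (σP : Fin p → ℝ) (σQ : Fin m → ℝ) :
    Matrix (EigIdx n m k p) (EigIdx n m k p) ℝ :=
  -fromBlocks
    ((diagonal σQ ^ 2) ⊗ₖ (1 : Matrix (Fin p) (Fin p) ℝ) +
      (1 : Matrix (Fin m) (Fin m) ℝ) ⊗ₖ (diagonal σP ^ 2)) 0
    0 (fromBlocks
      ((diagonal σQ ^ 2) ⊗ₖ (1 : Matrix (Fin (n - p)) (Fin (n - p)) ℝ)) 0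
      0 0)

end Eigenbasis

end GradFlow

/-! On factorizations of `Y` the residual vanishes, so the product rule differentiates only the
residual: a direction (H, G) goes to -((HQᵀ + PGᵀ)Q, (HQᵀ + PGᵀ)ᵀP), which is `targetJacobian`.

For left and right singular vectors φᵢ, γᵢ of Q and ψⱼ, ηⱼ of P, the plane spanned by [γᵢ ⊗ ψⱼ; 0]
and [0; Kᵀ(φᵢ ⊗ ηⱼ)] is invariant. There J is -vvᵀ with v = (σᵢ, τⱼ), the two singular values. So v
itself (a column of V₁) has eigenvalue -(σᵢ² + τⱼ²), and (-τⱼ, σᵢ) (a column of V₃) lies in the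
kernel. Columns of V₂, V₄ and V₅ pair a singular vector with a null direction of P or Q, and the
coupling disappears.

In the proof every block has the shape [A ⊗ B; Kᵀ(C ⊗ D)], for which `targetJacobian_mul_fromRows`
and `fromRows_gram` give JV and VᵀV in closed form. VᵀV is diagonal and positive, which yields
orthogonality and independence; a column count makes V a basis, and the basis determines the
characteristic polynomial. -/

namespace GradFlow

variable {n m k p : ℕ}

/-! ### The derivative of the flow -/

theorem targetJacobian_mulVec_stack (P H : Matrix (Fin n) (Fin k) ℝ)
    (Q G : Matrix (Fin m) (Fin k) ℝ) :
    targetJacobian P Q *ᵥ stack H G =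
      -stack (H * (Qᵀ * Q) + P * Gᵀ * Q) (Q * Hᵀ * P + G * (Pᵀ * P)) := by
  unfold targetJacobian stack
  rw [neg_mulVec, fromBlocks_mulVec]
  congr 1
  simp only [Sum.elim_comp_inl, Sum.elim_comp_inr, ← mulVec_mulVec, commMatrix_mulVec_vec,
    kronecker_mulVec_vec]
  congr 1 <;> ext x <;> simp [Matrix.mul_assoc]

theorem hasFDerivAt_vecFlow (P : Matrix (Fin n) (Fin k) ℝ) (Q : Matrix (Fin m) (Fin k) ℝ) :
    HasFDerivAt (vecFlow (k := k) (P * Qᵀ))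
      (LinearMap.toContinuousLinearMap (toLin' (targetJacobian P Q))) (stack P Q) := by
  have hl : ∀ c i, HasFDerivAt (fun z : StateIdx n m k → ℝ => z (Sum.inl (c, i)))
      (ContinuousLinearMap.proj (R := ℝ) (φ := fun _ : StateIdx n m k => ℝ) (Sum.inl (c, i)))
      (stack P Q) := fun c i => hasFDerivAt_apply _ _
  have hr : ∀ c l, HasFDerivAt (fun z : StateIdx n m k → ℝ => z (Sum.inr (c, l)))
      (ContinuousLinearMap.proj (R := ℝ) (φ := fun _ : StateIdx n m k => ℝ) (Sum.inr (c, l)))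
      (stack P Q) := fun c i => hasFDerivAt_apply _ _
  -- Entries of the residual. Their value at `stack P Q` is zero, so below one of the two
  -- product-rule terms drops out.
  have hE := fun i l => (HasFDerivAt.fun_sum (u := Finset.univ)
    fun (c : Fin k) _ => (hl c i).mul (hr c l)).const_sub ((P * Qᵀ) i l)
  rw [hasFDerivAt_pi']
  rintro (⟨j, i⟩ | ⟨j, l⟩)
  · refine ((HasFDerivAt.fun_sum (u := Finset.univ)
      fun (l : Fin m) _ => (hE i l).mul (hr j l))).congr_fderiv ?_
    ext h
    obtain ⟨H, G, rfl⟩ : ∃ H G, h = stack H G :=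
      ⟨unvec fun x => h (Sum.inl x), unvec fun x => h (Sum.inr x), by
        ext (x | x) <;> rfl⟩
    simp only [ContinuousLinearMap.comp_apply, LinearMap.coe_toContinuousLinearMap',
      toLin'_apply, targetJacobian_mulVec_stack]
    simp [stack, mul_apply, Finset.sum_add_distrib, Finset.mul_sum, Finset.sum_mul]
    rw [add_comm, Finset.sum_comm (f := fun x y => H i x * _)]
    congr 2
    · exact Finset.sum_congr rfl fun _ _ => Finset.sum_congr rfl fun _ _ => by ring
    · exact Finset.sum_congr rfl fun _ _ => Finset.sum_congr rfl fun _ _ => by ring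
  · refine ((HasFDerivAt.fun_sum (u := Finset.univ)
      fun (i : Fin n) _ => (hE i l).mul (hl j i))).congr_fderiv ?_
    ext h
    obtain ⟨H, G, rfl⟩ : ∃ H G, h = stack H G :=
      ⟨unvec fun x => h (Sum.inl x), unvec fun x => h (Sum.inr x), by
        ext (x | x) <;> rfl⟩
    simp only [ContinuousLinearMap.comp_apply, LinearMap.coe_toContinuousLinearMap',
      toLin'_apply, targetJacobian_mulVec_stack]
    simp [stack, mul_apply, Finset.sum_add_distrib, Finset.mul_sum, Finset.sum_mul]
    rw [add_comm, Finset.sum_comm (f := fun x y => G l x * _)]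
    congr 2
    · exact Finset.sum_congr rfl fun _ _ => Finset.sum_congr rfl fun _ _ => by ring
    · exact Finset.sum_congr rfl fun _ _ => Finset.sum_congr rfl fun _ _ => by ring

/-! ### Commutation matrices -/

theorem mul_commMatrix_transpose (a b : ℕ) : commMatrix a b * (commMatrix a b)ᵀ = 1 := by
  have h : commMatrix a b = (1 : Matrix (Fin a × Fin b) (Fin a × Fin b) ℝ).submatrix id
      (Equiv.prodComm _ _) := by
    ext x y
    simp [commMatrix, one_apply, Prod.ext_iff, and_comm]
  rw [h, transpose_submatrix, submatrix_mul_equiv]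
  simp

theorem commMatrix_mul_kronecker {a b : ℕ} {α β : Type} (A : Matrix (Fin b) α ℝ)
    (B : Matrix (Fin a) β ℝ) :
    commMatrix a b * (A ⊗ₖ B) = (B ⊗ₖ A).submatrix id Prod.swap := by
  ext x y
  simp [commMatrix, mul_apply, one_apply, mul_comm]

theorem transpose_commMatrix_mul_kronecker {a b : ℕ} {α β : Type} (A : Matrix (Fin a) α ℝ)
    (B : Matrix (Fin b) β ℝ) :
    (commMatrix a b)ᵀ * (A ⊗ₖ B) = (B ⊗ₖ A).submatrix id Prod.swap := by
  ext x y
  rw [mul_apply, Finset.sum_eq_single x.swap]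
  · simp [commMatrix, one_apply, mul_comm]
  · rintro b - hb
    have : b.swap ≠ x := fun h => hb (by rw [← h, Prod.swap_swap])
    simp [commMatrix, one_apply, this]
  · simp

/-! ### Existence of the singular value decompositions -/

theorem exists_isOrthogonal_fromCols {n r : ℕ} (A : Matrix (Fin n) (Fin r) ℝ) (hA : Aᵀ * A = 1) :
    ∃ B : Matrix (Fin n) (Fin (n - r)) ℝ, IsOrthogonal (fromCols A B) := by
  let v : Fin r → EuclideanSpace ℝ (Fin n) := fun i => WithLp.toLp 2 (A.col i)
  have hv : Orthonormal ℝ v := by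
    rw [orthonormal_iff_ite]
    intro i j
    have h := congrFun (congrFun hA i) j
    rw [one_apply, mul_apply] at h
    rw [← h]
    simp [v, PiLp.inner_apply, mul_comm]
  have hr : r ≤ n := by simpa using hv.linearIndependent.fintype_card_le_finrank
  have hcard : Module.finrank ℝ (EuclideanSpace ℝ (Fin n)) =
      Fintype.card (Fin r ⊕ Fin (n - r)) := by simp; omega
  have hv' : Orthonormal ℝ ((Set.range Sum.inl).domRestrict
      (Sum.elim v 0 : Fin r ⊕ Fin (n - r) → EuclideanSpace ℝ (Fin n))) := by
    have := hv.comp _ (Equiv.ofInjective (Sum.inl : Fin r → Fin r ⊕ Fin (n - r))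
      Sum.inl_injective).symm.injective
    convert this using 1
    ext1 ⟨_, i, rfl⟩
    have : (Equiv.ofInjective (Sum.inl : Fin r → Fin r ⊕ Fin (n - r)) Sum.inl_injective).symm
        ⟨Sum.inl i, i, rfl⟩ = i := Equiv.ofInjective_symm_apply _ i
    simp [this]
  obtain ⟨b, hb⟩ := hv'.exists_orthonormalBasis_extension_of_card_eq hcard
  refine ⟨of fun x j => b (Sum.inr j) x, ?_⟩
  have hW : fromCols A (of fun x j => b (Sum.inr j) x) = of fun x i => b i x := by
    ext x (i | i)
    · simp [hb (Sum.inl i) ⟨i, rfl⟩, v]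
    · simp
  have h1 : (of fun x i => b i x : Matrix (Fin n) _ ℝ)ᵀ * (of fun x i => b i x) = 1 := by
    ext i j
    rw [one_apply, ← orthonormal_iff_ite.1 b.orthonormal i j]
    simp [mul_apply, PiLp.inner_apply, mul_comm]
  rw [hW]
  exact ⟨h1, (mul_eq_one_comm_of_card_eq _ _ _ (by simp; omega)).1 h1⟩

/-- Diagonalize `Aᵀ * A` by an orthogonal W with the nonzero eigenvalues first. The columns of `A *
W` are orthogonal with squared norms the eigenvalues: normalizing the nonzero ones gives `Ψ₂`, and
the others vanish. -/
theorem exists_isPartitionedSVD (A : Matrix (Fin n) (Fin k) ℝ) :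
    ∃ Ψ₂ Ψ₃ σ Γ₂ Γ₃, IsPartitionedSVD A Ψ₂ Ψ₃ σ Γ₂ Γ₃ := by
  have hH : (Aᵀ * A).IsHermitian := by simpa using isHermitian_conjTranspose_mul_self A
  have hr := hH.rank_eq_card_non_zero_eigs
  rw [rank_transpose_mul_self] at hr
  have hc : Fintype.card {i // ¬ hH.eigenvalues i ≠ 0} = k - A.rank := by
    rw [Fintype.card_subtype_compl, ← hr, Fintype.card_fin]
  let e : Fin A.rank ⊕ Fin (k - A.rank) ≃ Fin k :=
    ((Fintype.equivFinOfCardEq hr.symm).symm.sumCongr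
      (Fintype.equivFinOfCardEq hc).symm).trans (Equiv.sumCompl _)
  let U : Matrix (Fin k) (Fin k) ℝ := hH.eigenvectorUnitary
  have hU : Uᵀ * U = 1 := Unitary.coe_star_mul_self hH.eigenvectorUnitary
  have hU' : U * Uᵀ = 1 := Unitary.coe_mul_star_self hH.eigenvectorUnitary
  have hD : Aᵀ * A * U = U * diagonal hH.eigenvalues := by
    ext i j
    rw [mul_diagonal, mul_comm (U i j)]
    exact congrFun (hH.mulVec_eigenvectorBasis j) i
  let W := U.submatrix id e
  have hW : Wᵀ * W = 1 := by
    simp [W, transpose_submatrix, hU, ← submatrix_mul]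
  have hW' : W * Wᵀ = 1 := by
    simp only [W, transpose_submatrix]
    rw [submatrix_mul_equiv, hU', submatrix_id_id]
  let d := hH.eigenvalues ∘ e
  have hB : (A * W)ᵀ * (A * W) = diagonal d := by
    have : (A * W) = (A * U).submatrix id e := rfl
    rw [this, transpose_submatrix, ← submatrix_mul _ _ _ _ _ Function.bijective_id, transpose_mul,
      Matrix.mul_assoc, ← Matrix.mul_assoc Aᵀ, hD, ← Matrix.mul_assoc, hU, Matrix.one_mul]
    simp [d]
  have hd : ∀ i j, ∑ x, (A * W) x i * (A * W) x j = diagonal d i j := fun i j => by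
    rw [← hB, mul_apply]; rfl
  have hd0 : ∀ j, d (Sum.inr j) = 0 := fun j => by
    simpa [d, e] using ((Fintype.equivFinOfCardEq hc).symm j).2
  have hdpos : ∀ j, 0 < d (Sum.inl j) := fun j => by
    refine lt_of_le_of_ne ?_ ?_
    · rw [← diagonal_apply_eq d, ← hd]
      exact Finset.sum_nonneg fun x _ => mul_self_nonneg _
    · exact ((Fintype.equivFinOfCardEq hr.symm).symm j).2.symm
  have hB0 : ∀ x j, (A * W) x (Sum.inr j) = 0 := fun x j => by
    have h := hd (Sum.inr j) (Sum.inr j)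
    rw [diagonal_apply_eq, hd0, Finset.sum_eq_zero_iff_of_nonneg fun x _ => mul_self_nonneg _] at h
    exact mul_self_eq_zero.1 (h x (Finset.mem_univ _))
  let σ : Fin A.rank → ℝ := fun i => √(d (Sum.inl i))
  have hσ : ∀ i, 0 < σ i := fun i => Real.sqrt_pos.2 (hdpos i)
  let Ψ₂ : Matrix (Fin n) (Fin A.rank) ℝ := of fun x i => (A * W) x (Sum.inl i) / σ i
  have hΨ : Ψ₂ᵀ * Ψ₂ = 1 := by
    ext i j
    have h := hd (Sum.inl i) (Sum.inl j)
    have h2 : (Ψ₂ᵀ * Ψ₂) i j =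
        (∑ x, (A * W) x (Sum.inl i) * (A * W) x (Sum.inl j)) / (σ i * σ j) := by
      rw [mul_apply, Finset.sum_div]
      exact Finset.sum_congr rfl fun x _ => div_mul_div_comm _ _ _ _
    rw [h2, h]
    obtain rfl | hij := eq_or_ne i j
    · rw [diagonal_apply_eq, one_apply_eq, Real.mul_self_sqrt (hdpos i).le,
        div_self (hdpos i).ne']
    · rw [diagonal_apply_ne _ (by simpa using hij), one_apply_ne hij, zero_div]
  obtain ⟨Ψ₃, hΨ₃⟩ := exists_isOrthogonal_fromCols Ψ₂ hΨ
  refine ⟨Ψ₂, Ψ₃, σ, W.toCols₁, W.toCols₂, hΨ₃, ?_, hσ, ?_⟩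
  · rw [fromCols_toCols]; exact ⟨hW, hW'⟩
  · rw [fromCols_toCols]
    have h : A * W = fromCols Ψ₂ Ψ₃ * (fromBlocks (diagonal σ) 0 0 0 :
      Matrix (Fin A.rank ⊕ Fin (n - A.rank)) (Fin A.rank ⊕ Fin (k - A.rank)) ℝ) := by
      rw [fromCols_mul_fromBlocks]
      ext x (i | i)
      · simp [Ψ₂, mul_diagonal, div_mul_cancel₀ _ (hσ i).ne']
      · simp [hB0]
    rw [← h, Matrix.mul_assoc, hW', Matrix.mul_one]

theorem exists_isFullRowRankSVD (A : Matrix (Fin m) (Fin k) ℝ) (hA : A.rank = m) :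
    ∃ Φ σ Γ₂ Γ₃, IsFullRowRankSVD A Φ σ Γ₂ Γ₃ := by
  obtain ⟨Ψ₂, Ψ₃, σ, Γ₂, Γ₃, h1, h2, h3, h4⟩ := exists_isPartitionedSVD A
  -- The rank occurs in the types, so it must become a variable before it can be identified with
  -- `m`; then `Ψ₃` has no columns.
  generalize A.rank = r at *
  subst hA
  have : IsEmpty (Fin (r - r)) := by rw [Nat.sub_self]; infer_instance
  refine ⟨Ψ₂, σ, Γ₂, Γ₃, ⟨?_, ?_⟩, h2, h3, ?_⟩
  · have := h1.1
    rw [transpose_fromCols, fromRows_mul_fromCols, ← fromBlocks_one, fromBlocks_inj] at this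
    exact this.1
  · have := h1.2
    rw [transpose_fromCols, fromCols_mul_fromRows] at this
    have h0 : Ψ₃ * Ψ₃ᵀ = 0 := by ext; simp [mul_apply]
    rwa [h0, add_zero] at this
  · rw [h4]
    simp only [fromCols_mul_fromBlocks, mul_fromCols, Matrix.mul_zero, add_zero]

/-! ### Block columns, their Gram matrix and the action of J -/

section Relations
variable {P : Matrix (Fin n) (Fin k) ℝ} {Q : Matrix (Fin m) (Fin k) ℝ}
  {Ψ₂ : Matrix (Fin n) (Fin P.rank) ℝ} {Ψ₃ : Matrix (Fin n) (Fin (n - P.rank)) ℝ}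
  {σP : Fin P.rank → ℝ}
  {ΓP₂ : Matrix (Fin k) (Fin P.rank) ℝ} {ΓP₃ : Matrix (Fin k) (Fin (k - P.rank)) ℝ}
  {Φ : Matrix (Fin m) (Fin m) ℝ} {σQ : Fin m → ℝ}
  {ΓQ₂ : Matrix (Fin k) (Fin m) ℝ} {ΓQ₃ : Matrix (Fin k) (Fin (k - m)) ℝ}

theorem neg_kronecker {l₁ l₂ α β : Type} (A : Matrix l₁ α ℝ) (B : Matrix l₂ β ℝ) :
    (-A) ⊗ₖ B = -(A ⊗ₖ B) := by
  ext
  simp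

theorem IsOrthogonal.fromCols_relations {ι κ₁ κ₂ : Type} [Fintype ι] [Fintype κ₁] [Fintype κ₂]
    [DecidableEq ι] [DecidableEq κ₁] [DecidableEq κ₂] {A : Matrix ι κ₁ ℝ} {B : Matrix ι κ₂ ℝ}
    (h : IsOrthogonal (fromCols A B)) :
    Aᵀ * A = 1 ∧ Aᵀ * B = 0 ∧ Bᵀ * A = 0 ∧ Bᵀ * B = 1 := by
  have := h.1
  rwa [transpose_fromCols, fromRows_mul_fromCols, ← fromBlocks_one, fromBlocks_inj] at this

theorem IsPartitionedSVD.compact (h : IsPartitionedSVD P Ψ₂ Ψ₃ σP ΓP₂ ΓP₃) :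
    P = Ψ₂ * diagonal σP * ΓP₂ᵀ := by
  refine h.eq.trans ?_
  rw [fromCols_mul_fromBlocks, transpose_fromCols, fromCols_mul_fromRows]
  simp

theorem IsFullRowRankSVD.compact (h : IsFullRowRankSVD Q Φ σQ ΓQ₂ ΓQ₃) :
    Q = Φ * diagonal σQ * ΓQ₂ᵀ := by
  rw [h.eq, mul_fromCols, transpose_fromCols, fromCols_mul_fromRows]
  simp

/-- The diagonal entries of `Vᵀ V`. -/
def gramEntry (n k : ℕ) (σP : Fin p → ℝ) (σQ : Fin m → ℝ) : EigIdx n m k p → ℝ :=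
  Sum.elim (fun a => σQ a.1 ^ 2 + σP a.2 ^ 2) <| Sum.elim (fun _ => 1) <|
    Sum.elim (fun a => σQ a.1 ^ 2 + σP a.2 ^ 2) fun _ => 1

/-- The diagonal entries of `Λ`. -/
def eigenvalueEntry (n k : ℕ) (σP : Fin p → ℝ) (σQ : Fin m → ℝ) : EigIdx n m k p → ℝ :=
  Sum.elim (fun a => -(σQ a.1 ^ 2 + σP a.2 ^ 2)) <| Sum.elim (fun a => -σQ a.1 ^ 2) 0

theorem diagonal_sq_kronecker_one_add (σP : Fin p → ℝ) (σQ : Fin m → ℝ) :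
    (diagonal σQ ^ 2) ⊗ₖ (1 : Matrix (Fin p) (Fin p) ℝ) +
      (1 : Matrix (Fin m) (Fin m) ℝ) ⊗ₖ (diagonal σP ^ 2) =
    diagonal fun a : Fin m × Fin p => σQ a.1 ^ 2 + σP a.2 ^ 2 := by
  simp only [diagonal_pow, ← diagonal_one, diagonal_kronecker_diagonal, diagonal_add]
  simp

theorem eigenvalueMatrix_eq_diagonal (σP : Fin p → ℝ) (σQ : Fin m → ℝ) :
    eigenvalueMatrix n k σP σQ = diagonal (eigenvalueEntry n k σP σQ) := by
  unfold eigenvalueMatrix eigenvalueEntry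
  rw [diagonal_sq_kronecker_one_add]
  simp only [diagonal_pow, ← diagonal_one, diagonal_kronecker_diagonal]
  rw [← diagonal_zero, fromBlocks_diagonal, fromBlocks_diagonal, diagonal_neg]
  congr 1
  ext (a | b | c) <;> simp

theorem transpose_comm_mul_mul_comm_mul {α β : Type} {a b : ℕ} (A : Matrix (Fin a × Fin b) α ℝ)
    (B : Matrix (Fin a × Fin b) β ℝ) :
    ((commMatrix a b)ᵀ * A)ᵀ * ((commMatrix a b)ᵀ * B) = Aᵀ * B := by
  rw [transpose_mul, transpose_transpose, Matrix.mul_assoc, ← Matrix.mul_assoc (commMatrix a b),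
    mul_commMatrix_transpose, Matrix.one_mul]

theorem kronecker_mul_comm_mul_kronecker {α β : Type} (A : Matrix (Fin m) α ℝ)
    (B : Matrix (Fin k) β ℝ) (P : Matrix (Fin n) (Fin k) ℝ) (Q : Matrix (Fin m) (Fin k) ℝ) :
    (Qᵀ ⊗ₖ P) * commMatrix m k * ((commMatrix m k)ᵀ * (A ⊗ₖ B)) = (Qᵀ * A) ⊗ₖ (P * B) := by
  rw [Matrix.mul_assoc, ← Matrix.mul_assoc (commMatrix m k), mul_commMatrix_transpose,
    Matrix.one_mul, mul_kronecker_mul]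

theorem kronecker_mul_submatrix_swap {l₁ l₂ α β : Type} {a b : ℕ} (G : Matrix l₁ (Fin a) ℝ)
    (H : Matrix l₂ (Fin b) ℝ) (A : Matrix (Fin a) α ℝ) (B : Matrix (Fin b) β ℝ) :
    (G ⊗ₖ H) * (A ⊗ₖ B).submatrix id Prod.swap =
      ((G * A) ⊗ₖ (H * B)).submatrix id (Prod.swap : β × α → α × β) := by
  rw [mul_kronecker_mul]
  rfl

/-- K swaps Kronecker factors, so it passes through the product and reappears on the left as a
transpose. -/
theorem kronecker_mul_commMatrix_mul_kronecker {α β : Type} (A : Matrix (Fin k) α ℝ)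
    (B : Matrix (Fin n) β ℝ) (P : Matrix (Fin n) (Fin k) ℝ) (Q : Matrix (Fin m) (Fin k) ℝ) :
    (Pᵀ ⊗ₖ Q) * commMatrix n k * (A ⊗ₖ B) =
      (commMatrix m k)ᵀ * ((Q * A) ⊗ₖ (Pᵀ * B)) := by
  rw [Matrix.mul_assoc, commMatrix_mul_kronecker, kronecker_mul_submatrix_swap,
    transpose_commMatrix_mul_kronecker]

theorem kronecker_one_mul_transpose_commMatrix {α β : Type} (A : Matrix (Fin m) α ℝ)
    (B : Matrix (Fin k) β ℝ) (G : Matrix (Fin k) (Fin k) ℝ) :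
    (G ⊗ₖ (1 : Matrix (Fin m) (Fin m) ℝ)) * ((commMatrix m k)ᵀ * (A ⊗ₖ B)) =
      (commMatrix m k)ᵀ * (A ⊗ₖ (G * B)) := by
  rw [transpose_commMatrix_mul_kronecker, kronecker_mul_submatrix_swap,
    transpose_commMatrix_mul_kronecker, Matrix.one_mul]

/-- The action of `J` on a block column `[A ⊗ B; Kᵀ (C ⊗ D)]`. -/
theorem targetJacobian_mul_fromRows {α β : Type} (P : Matrix (Fin n) (Fin k) ℝ)
    (Q : Matrix (Fin m) (Fin k) ℝ) (A : Matrix (Fin k) α ℝ) (B : Matrix (Fin n) β ℝ)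
    (C : Matrix (Fin m) α ℝ) (D : Matrix (Fin k) β ℝ) :
    targetJacobian P Q * fromRows (A ⊗ₖ B) ((commMatrix m k)ᵀ * (C ⊗ₖ D)) =
      -fromRows ((Qᵀ * (Q * A)) ⊗ₖ B + (Qᵀ * C) ⊗ₖ (P * D))
        ((commMatrix m k)ᵀ * ((Q * A) ⊗ₖ (Pᵀ * B) + C ⊗ₖ (Pᵀ * (P * D)))) := by
  rw [targetJacobian, Matrix.neg_mul, fromBlocks_mul_fromRows, kronecker_mul_comm_mul_kronecker,
    kronecker_mul_commMatrix_mul_kronecker, kronecker_one_mul_transpose_commMatrix,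
    ← mul_kronecker_mul, Matrix.one_mul, Matrix.mul_add, Matrix.mul_assoc, Matrix.mul_assoc]

theorem fromRows_gram {α β γ δ : Type} (A : Matrix (Fin k) α ℝ) (B : Matrix (Fin n) β ℝ)
    (C : Matrix (Fin m) α ℝ) (D : Matrix (Fin k) β ℝ) (A' : Matrix (Fin k) γ ℝ)
    (B' : Matrix (Fin n) δ ℝ) (C' : Matrix (Fin m) γ ℝ) (D' : Matrix (Fin k) δ ℝ) :
    (fromRows (A ⊗ₖ B) ((commMatrix m k)ᵀ * (C ⊗ₖ D)))ᵀ *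
      fromRows (A' ⊗ₖ B') ((commMatrix m k)ᵀ * (C' ⊗ₖ D')) =
      (Aᵀ * A') ⊗ₖ (Bᵀ * B') + (Cᵀ * C') ⊗ₖ (Dᵀ * D') := by
  rw [transpose_fromRows, fromCols_mul_fromRows, transpose_comm_mul_mul_comm_mul,
    ← kroneckerMap_transpose, ← kroneckerMap_transpose, mul_kronecker_mul, mul_kronecker_mul]

/-- Writing the zero block as Kᵀ(0 ⊗ 0) lets the general block-column formulas apply. -/
theorem V₂_eq (Ψ₃ : Matrix (Fin n) (Fin (n - p)) ℝ) (ΓQ₂ : Matrix (Fin k) (Fin m) ℝ) :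
    V₂ Ψ₃ ΓQ₂ = fromRows (ΓQ₂ ⊗ₖ Ψ₃) ((commMatrix m k)ᵀ *
      ((0 : Matrix (Fin m) (Fin m) ℝ) ⊗ₖ (0 : Matrix (Fin k) (Fin (n - p)) ℝ))) := by
  simp [V₂]

theorem V₄_eq (Ψ₂ : Matrix (Fin n) (Fin p) ℝ) (Ψ₃ : Matrix (Fin n) (Fin (n - p)) ℝ)
    (ΓQ₃ : Matrix (Fin k) (Fin (k - m)) ℝ) :
    V₄ Ψ₂ Ψ₃ ΓQ₃ = fromRows (ΓQ₃ ⊗ₖ fromCols Ψ₂ Ψ₃) ((commMatrix m k)ᵀ *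
      ((0 : Matrix (Fin m) (Fin (k - m)) ℝ) ⊗ₖ
        (0 : Matrix (Fin k) (Fin p ⊕ Fin (n - p)) ℝ))) := by
  simp [V₄]

theorem V₅_eq (ΓP₃ : Matrix (Fin k) (Fin (k - p)) ℝ) (Φ : Matrix (Fin m) (Fin m) ℝ) :
    V₅ (n := n) ΓP₃ Φ = fromRows ((0 : Matrix (Fin k) (Fin m) ℝ) ⊗ₖ
      (0 : Matrix (Fin n) (Fin (k - p)) ℝ)) ((commMatrix m k)ᵀ * (Φ ⊗ₖ ΓP₃)) := by
  simp [V₅]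

theorem gram_fromCols {ι α β : Type} [Fintype ι] [DecidableEq α] [DecidableEq β]
    {A : Matrix ι α ℝ} {B : Matrix ι β ℝ} {d : α → ℝ} {e : β → ℝ} (hA : Aᵀ * A = diagonal d)
    (hAB : Aᵀ * B = 0) (hB : Bᵀ * B = diagonal e) :
    (fromCols A B)ᵀ * fromCols A B = diagonal (Sum.elim d e) := by
  have hBA : Bᵀ * A = 0 := by rw [← transpose_transpose A, ← transpose_mul, hAB, transpose_zero]
  rw [transpose_fromCols, fromRows_mul_fromCols, hA, hAB, hB, hBA, fromBlocks_diagonal]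

theorem mul_fromCols_eq_mul_fromBlocks {ι α β : Type} [Fintype ι] [Fintype α] [Fintype β]
    {J : Matrix ι ι ℝ} {A : Matrix ι α ℝ} {B : Matrix ι β ℝ} {L : Matrix α α ℝ} {M : Matrix β β ℝ}
    (hA : J * A = A * L) (hB : J * B = B * M) :
    J * fromCols A B = fromCols A B * fromBlocks L 0 0 M := by
  rw [mul_fromCols, fromCols_mul_fromBlocks, hA, hB]
  simp

theorem mul_cancel_left_of_eq_one {ι α β : Type} [Fintype ι] [Fintype α] [DecidableEq α]
    {A : Matrix α ι ℝ} {B : Matrix ι α ℝ} (h : A * B = 1) (C : Matrix α β ℝ) :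
    A * (B * C) = C := by
  rw [← Matrix.mul_assoc, h, Matrix.one_mul]

theorem mul_mul_eq_zero_of_eq_zero {ι α β γ : Type} [Fintype ι] [Fintype α]
    {A : Matrix γ ι ℝ} {B : Matrix ι α ℝ} (h : A * B = 0) (C : Matrix α β ℝ) :
    A * (B * C) = 0 := by
  rw [← Matrix.mul_assoc, h, Matrix.zero_mul]

theorem gram_eigenMatrix (hP : IsPartitionedSVD P Ψ₂ Ψ₃ σP ΓP₂ ΓP₃)
    (hQ : IsFullRowRankSVD Q Φ σQ ΓQ₂ ΓQ₃) :
    (eigenMatrix Ψ₂ Ψ₃ σP ΓP₂ ΓP₃ Φ σQ ΓQ₂ ΓQ₃)ᵀ * eigenMatrix Ψ₂ Ψ₃ σP ΓP₂ ΓP₃ Φ σQ ΓQ₂ ΓQ₃ =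
      diagonal (gramEntry n k σP σQ) := by
  obtain ⟨h1, h2, h3, h4⟩ := hP.left_orthogonal.fromCols_relations
  obtain ⟨g1, g2, g3, g4⟩ := hP.right_orthogonal.fromCols_relations
  obtain ⟨q1, q2, q3, q4⟩ := hQ.right_orthogonal.fromCols_relations
  have hΦ := hQ.left_orthogonal.1
  have hΨ := hP.left_orthogonal.1
  have e1 := diagonal_sq_kronecker_one_add σP σQ
  rw [pow_two, pow_two, diagonal_mul_diagonal, diagonal_mul_diagonal] at e1
  -- The cross term of V₁ and V₃; the minus sign in V₃ makes it cancel.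
  have e2 : (diagonal fun i => -σQ i) ⊗ₖ diagonal σP + diagonal σQ ⊗ₖ diagonal σP = 0 := by
    rw [← add_kronecker, diagonal_add]
    simp
  unfold eigenMatrix gramEntry
  rw [V₂_eq, V₄_eq, V₅_eq, V₁, V₃]
  refine gram_fromCols ?_ ?_ <| gram_fromCols ?_ ?_ <| gram_fromCols ?_ ?_ <|
      (gram_fromCols (d := fun _ => 1) (e := fun _ => 1) ?_ ?_ ?_).trans ?_
  all_goals try simp only [mul_fromCols, fromRows_gram, transpose_mul, Matrix.mul_assoc, diagonal_transpose,
      transpose_neg, Matrix.neg_mul, Matrix.mul_neg, transpose_zero, mul_cancel_left_of_eq_one h1, mul_cancel_left_of_eq_one g1,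
      mul_cancel_left_of_eq_one q1, mul_cancel_left_of_eq_one hΦ, mul_mul_eq_zero_of_eq_zero h3,
       
      h1, h2, h3, h4, g1, g2, g4, q1, q2, q4, hΦ, hΨ]
  all_goals simp [e2, e1]
  rw [add_comm, e1]

theorem targetJacobian_mul_eigenMatrix (hP : IsPartitionedSVD P Ψ₂ Ψ₃ σP ΓP₂ ΓP₃)
    (hQ : IsFullRowRankSVD Q Φ σQ ΓQ₂ ΓQ₃) :
    targetJacobian P Q * eigenMatrix Ψ₂ Ψ₃ σP ΓP₂ ΓP₃ Φ σQ ΓQ₂ ΓQ₃ =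
      eigenMatrix Ψ₂ Ψ₃ σP ΓP₂ ΓP₃ Φ σQ ΓQ₂ ΓQ₃ * eigenvalueMatrix n k σP σQ := by
  obtain ⟨h1, h2, h3, h4⟩ := hP.left_orthogonal.fromCols_relations
  obtain ⟨g1, g2, g3, g4⟩ := hP.right_orthogonal.fromCols_relations
  obtain ⟨q1, q2, q3, q4⟩ := hQ.right_orthogonal.fromCols_relations
  have hΦ := hQ.left_orthogonal.1
  have hQ' := hQ.compact
  have hP' := hP.compact
  have b1 : Q * ΓQ₂ = Φ * diagonal σQ := by
    rw [hQ', Matrix.mul_assoc, q1, Matrix.mul_one]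
  have b2 : Q * ΓQ₃ = 0 := by
    rw [hQ', Matrix.mul_assoc, q2, Matrix.mul_zero]
  have b3 : Qᵀ * Φ = ΓQ₂ * diagonal σQ := by
    rw [hQ']
    simp [Matrix.mul_assoc, hΦ]
  clear hP hQ hQ'
  -- Otherwise rewriting P by its decomposition would also hit `P.rank` inside the types.
  generalize P.rank = r at *
  have a1 : P * ΓP₂ = Ψ₂ * diagonal σP := by
    rw [hP', Matrix.mul_assoc, g1, Matrix.mul_one]
  have a2 : P * ΓP₃ = 0 := by
    rw [hP', Matrix.mul_assoc, g2, Matrix.mul_zero]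
  have a3 : Pᵀ * Ψ₂ = ΓP₂ * diagonal σP := by
    rw [hP']
    simp [Matrix.mul_assoc, h1]
  have a4 : Pᵀ * Ψ₃ = 0 := by
    rw [hP']
    simp [Matrix.mul_assoc, h2]
  have b3' : ∀ C : Matrix (Fin m) (Fin m) ℝ, Qᵀ * (Φ * C) = ΓQ₂ * (diagonal σQ * C) := fun C => by
    rw [← Matrix.mul_assoc, b3, Matrix.mul_assoc]
  have a3' : ∀ C : Matrix (Fin r) (Fin r) ℝ, Pᵀ * (Ψ₂ * C) = ΓP₂ * (diagonal σP * C) := fun C => by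
    rw [← Matrix.mul_assoc, a3, Matrix.mul_assoc]
  have b1' : ∀ C : Matrix (Fin m) (Fin m) ℝ, Q * (ΓQ₂ * C) = Φ * (diagonal σQ * C) := fun C => by
    rw [← Matrix.mul_assoc, b1, Matrix.mul_assoc]
  have a1' : ∀ C : Matrix (Fin r) (Fin r) ℝ, P * (ΓP₂ * C) = Ψ₂ * (diagonal σP * C) := fun C => by
    rw [← Matrix.mul_assoc, a1, Matrix.mul_assoc]
  unfold eigenMatrix eigenvalueMatrix
  rw [V₂_eq, V₄_eq, V₅_eq, V₁, V₃, fromBlocks_neg, fromBlocks_neg]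
  simp only [neg_zero]
  -- Three cases suffice: V₁, V₂, and the kernel part [V₃ V₄ V₅] as a single block.
  refine mul_fromCols_eq_mul_fromBlocks ?_ (mul_fromCols_eq_mul_fromBlocks ?_ ?_)
  all_goals
    simp only [mul_fromCols, targetJacobian_mul_fromRows, b1, b2, b3, a1, a2, a3, a4, b1', a1', b3',
      a3', fromRows_mul, Matrix.mul_assoc, Matrix.mul_add, Matrix.mul_neg,
      ← mul_kronecker_mul, Matrix.mul_one, pow_two]
  · simp only [diagonal_mul_diagonal, fromRows_neg]
    ext (x | x) y
    · simp [add_comm]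
    · simp [add_comm]
  · simp
  · simp [neg_kronecker]

end Relations

/-! ### From the Gram matrix and eigenvectors to basis and spectrum -/

theorem dotProduct_col_col {ι κ : Type} [Fintype ι] [DecidableEq κ] {V : Matrix ι κ ℝ} {g : κ → ℝ}
    (hV : Vᵀ * V = diagonal g) (c d : κ) : V.col c ⬝ᵥ V.col d = diagonal g c d := by
  rw [← hV]
  rfl

theorem linearIndependent_col_of_gram {ι κ : Type} [Fintype ι] [Fintype κ] [DecidableEq κ]
    {V : Matrix ι κ ℝ} {g : κ → ℝ} (hV : Vᵀ * V = diagonal g) (hg : ∀ c, g c ≠ 0) :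
    LinearIndependent ℝ V.col := by
  rw [← mulVec_injective_iff]
  intro x y hxy
  have h : diagonal g *ᵥ x = diagonal g *ᵥ y := by
    rw [← hV, ← mulVec_mulVec, ← mulVec_mulVec]
    exact congrArg _ hxy
  ext c
  have := congrFun h c
  rw [mulVec_diagonal, mulVec_diagonal] at this
  exact mul_left_cancel₀ (hg c) this

/-- A basis of eigenvectors exhibits the roots of the characteristic polynomial. -/
theorem roots_charpoly_of_basis {ι κ : Type} [Fintype ι] [DecidableEq ι] [Fintype κ]
    [DecidableEq κ] (J : Matrix ι ι ℝ) (b : Module.Basis κ ℝ (ι → ℝ)) (l : κ → ℝ)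
    (h : ∀ c, J *ᵥ b c = l c • b c) :
    J.charpoly.roots = Finset.univ.val.map l := by
  have hm : LinearMap.toMatrix b b (toLin' J) = diagonal l := by
    ext i j
    rw [LinearMap.toMatrix_apply, toLin'_apply, h]
    obtain rfl | hij := eq_or_ne i j
    · simp
    · simp [hij]
  rw [← charpoly_toLin', ← LinearMap.charpoly_toMatrix _ b, hm, charpoly_diagonal]
  exact Polynomial.roots_multiset_prod_X_sub_C (Finset.univ.val.map l) ▸ by simp

theorem gramEntry_pos {σP : Fin p → ℝ} {σQ : Fin m → ℝ} (hσ : ∀ i, 0 < σQ i) :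
    ∀ c : EigIdx n m k p, 0 < gramEntry n k σP σQ c := by
  have h : ∀ a : Fin m × Fin p, 0 < σQ a.1 ^ 2 + σP a.2 ^ 2 := fun a =>
    add_pos_of_pos_of_nonneg (pow_pos (hσ _) 2) (sq_nonneg _)
  rintro (a | a | a | a)
  exacts [h a, one_pos, h a, one_pos]

/-- mp + m(n - p) + mp + (k - m)n + m(k - p) = (n + m)k; the inequalities keep the natural
subtractions exact. -/
theorem card_eigIdx (hm : m ≤ k) (hp : p ≤ n) (hpk : p ≤ k) :
    Fintype.card (EigIdx n m k p) = Fintype.card (StateIdx n m k) := by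
  obtain ⟨a, rfl⟩ := Nat.exists_eq_add_of_le hm
  obtain ⟨b, rfl⟩ := Nat.exists_eq_add_of_le hp
  obtain ⟨c, hc⟩ := Nat.exists_eq_add_of_le hpk
  have h : m + a - p = c := by omega
  simp only [Fintype.card_sum, Fintype.card_prod, Fintype.card_fin, h, Nat.add_sub_cancel_left]
  have : (m + a) * m = m * (p + c) := by rw [hc, mul_comm]
  linarith

end GradFlow

theorem mainTheorem5 (n m k : ℕ) (Y : Matrix (Fin n) (Fin m) ℝ)
    (P : Matrix (Fin n) (Fin k) ℝ) (Q : Matrix (Fin m) (Fin k) ℝ)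
    (hT : Y = P * Qᵀ) :
    HasFDerivAt (GradFlow.vecFlow (k := k) Y)
      (LinearMap.toContinuousLinearMap (Matrix.toLin' (GradFlow.targetJacobian P Q)))
      (GradFlow.stack P Q) ∧
    (Y.rank = m →
      (∃ Ψ₂ Ψ₃ σP ΓP₂ ΓP₃, GradFlow.IsPartitionedSVD P Ψ₂ Ψ₃ σP ΓP₂ ΓP₃) ∧
      (∃ Φ σQ ΓQ₂ ΓQ₃, GradFlow.IsFullRowRankSVD Q Φ σQ ΓQ₂ ΓQ₃) ∧
      ∀ (Ψ₂ : Matrix (Fin n) (Fin P.rank) ℝ) (Ψ₃ : Matrix (Fin n) (Fin (n - P.rank)) ℝ)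
        (σP : Fin P.rank → ℝ)
        (ΓP₂ : Matrix (Fin k) (Fin P.rank) ℝ) (ΓP₃ : Matrix (Fin k) (Fin (k - P.rank)) ℝ)
        (Φ : Matrix (Fin m) (Fin m) ℝ) (σQ : Fin m → ℝ)
        (ΓQ₂ : Matrix (Fin k) (Fin m) ℝ) (ΓQ₃ : Matrix (Fin k) (Fin (k - m)) ℝ),
        GradFlow.IsPartitionedSVD P Ψ₂ Ψ₃ σP ΓP₂ ΓP₃ →
        GradFlow.IsFullRowRankSVD Q Φ σQ ΓQ₂ ΓQ₃ →
        ∀ J V Λ, J = GradFlow.targetJacobian P Q →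
        V = GradFlow.eigenMatrix Ψ₂ Ψ₃ σP ΓP₂ ΓP₃ Φ σQ ΓQ₂ ΓQ₃ →
        Λ = GradFlow.eigenvalueMatrix n k σP σQ →
        -- the columns of `V` are eigenvectors, with the diagonal entries of `Λ` as eigenvalues
        Λ.IsDiag ∧
        (∀ c, Module.End.HasEigenvector (Matrix.toLin' J) (Λ c c) (V.col c)) ∧
        -- they are pairwise orthogonal and form a basis of the whole space
        (∀ c d, c ≠ d → V.col c ⬝ᵥ V.col d = 0) ∧
        LinearIndependent ℝ V.col ∧
        Submodule.span ℝ (Set.range V.col) = ⊤ ∧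
        -- the eigenvalues of `J`, with multiplicity, are the diagonal entries of `Λ`
        J.charpoly.roots = Finset.univ.val.map (fun c => Λ c c) ∧
        -- those of the first two blocks are nonzero, all remaining ones vanish
        (∀ a, Λ (Sum.inl a) (Sum.inl a) < 0) ∧
        (∀ b, Λ (Sum.inr (Sum.inl b)) (Sum.inr (Sum.inl b)) < 0) ∧
        (∀ c, Λ (Sum.inr (Sum.inr c)) (Sum.inr (Sum.inr c)) = 0)) := by
  subst hT
  refine ⟨GradFlow.hasFDerivAt_vecFlow P Q, fun hY => ?_⟩
  -- The rank of a product is at most that of its right factor `Qᵀ`.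
  have hQr : Q.rank = m := by
    refine le_antisymm (by simpa using Q.rank_le_card_height) ?_
    rw [← Q.rank_transpose]
    exact hY.symm.le.trans (Matrix.rank_mul_le_right _ _)
  have hmk : m ≤ k := hQr.symm.le.trans (by simpa using Q.rank_le_card_width)
  refine ⟨GradFlow.exists_isPartitionedSVD P, GradFlow.exists_isFullRowRankSVD Q hQr, ?_⟩
  rintro Ψ₂ Ψ₃ σP ΓP₂ ΓP₃ Φ σQ ΓQ₂ ΓQ₃ hP hQ J V Λ hJ hV hΛ
  have hgram : Vᵀ * V = _ := hV ▸ GradFlow.gram_eigenMatrix hP hQ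
  have hmul : J * V = V * Λ := by
    rw [hJ, hV, hΛ]
    exact GradFlow.targetJacobian_mul_eigenMatrix hP hQ
  have hpos := GradFlow.gramEntry_pos (n := n) (k := k) (σP := σP) hQ.pos
  rw [GradFlow.eigenvalueMatrix_eq_diagonal] at hΛ
  subst hΛ
  have heig : ∀ c, J *ᵥ V.col c = GradFlow.eigenvalueEntry n k σP σQ c • V.col c := fun c => by
    ext x
    have := congrFun (congrFun hmul x) c
    rw [Matrix.mul_diagonal] at this
    rw [Pi.smul_apply, smul_eq_mul, mul_comm]
    exact this
  have hli := GradFlow.linearIndependent_col_of_gram hgram fun c => (hpos c).ne'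
  have hcard : Fintype.card (GradFlow.EigIdx n m k P.rank) =
      Module.finrank ℝ (GradFlow.StateIdx n m k → ℝ) := by
    rw [Module.finrank_fintype_fun_eq_card]
    exact GradFlow.card_eigIdx hmk (by simpa using P.rank_le_card_height)
      (by simpa using P.rank_le_card_width)
  have hspan := hli.span_eq_top_of_card_eq_finrank' hcard
  simp only [Matrix.diagonal_apply_eq]
  refine ⟨Matrix.isDiag_diagonal _, fun c => ?_, fun c d hcd => ?_, hli, hspan, ?_, ?_, ?_, ?_⟩
  · exact ⟨Module.End.mem_eigenspace_iff.2 (heig c), hli.ne_zero c⟩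
  · rw [GradFlow.dotProduct_col_col hgram, Matrix.diagonal_apply_ne _ hcd]
  · exact GradFlow.roots_charpoly_of_basis J (Module.Basis.mk hli hspan.ge) _ fun c => by
      rw [Module.Basis.mk_apply, heig]
  -- On V₁ the eigenvalue is minus the squared norm of the column.
  · exact fun a => neg_neg_of_pos (hpos (Sum.inl a))
  · exact fun b => neg_neg_of_pos (pow_pos (hQ.pos _) 2)
  · exact fun c => rfl
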